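/- For $n\ge 1$, $\theta\in\mathbb R$ and $\sigma>0$ let $P_{n,\theta,\sigma}$ denote the joint law of a sample $y_1,\dots,y_n$ of independent $N(\theta,\sigma^2)$ random variables. Write $\bar y=n^{-1}\sum_{i=1}^n y_i$ and, for $n\ge 2$, $\hat\sigma=\big((n-1)^{-1}\sum_{i=1}^n(y_i-\bar y)^2\big)^{1/2}$. For a threshold $t\ge 0$ and $x\in\mathbb R$ put $$T_t(x)=\begin{cases}0,&|x|\le t,\\ x-t^2/x,&|x|>t.\end{cases}$$ Given a tuning parameter $\eta_n>0$, the feasible adaptive LASSO estimator is $\tilde\theta_A=T_{\hat\sigma\eta_n}(\bar y)$ and its infeasible (known-variance) counterpart is $\hat\theta_A=T_{\sigma\eta_n}(\bar y)$. **Theorem.** Let $\sigma>0$, let $(\eta_n)_{n\ge2}$ be positive real numbers with $\eta_n\to0$, and let $(a_n)_{n\ge2}$ be an arbitrary sequence of nonnegative real numbers. With $$E_{A,n}=[\tilde\theta_A-\hat\sigma a_n,\ \tilde\theta_A+\hat\sigma a_n],\qquad C_{A,n}=[\hat\theta_A-\sigma a_n,\ \hat\theta_A+\sigma a_n],$$ we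 have $$\inf_{\theta\in\mathbb R}P_{n,\theta,\sigma}(\theta\in E_{A,n})-\inf_{\theta\in\mathbb R}P_{n,\theta,\sigma}(\theta\in C_{A,n})\longrightarrow0\qquad(n\to\infty).$$ The same holds if both intervals $E_{A,n}$ and $C_{A,n}$ are replaced by the corresponding open intervals, by the corresponding intervals that are open on the left and closed on the right, or by those that are closed on the left and open on the right. In particular, for $\sigma=1$ the known-variance interval is $[\hat\theta_A-a_n,\hat\theta_A+a_n]$. -/

import Mathlib

open MeasureTheory ProbabilityTheory Filter Topology

noncomputable section

namespace AdaptiveLasso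

/-- The joint law of an i.i.d. sample `y₁, …, yₙ` from the normal distribution `N(θ, σ²)`. -/
def sampleLaw (n : ℕ) (θ σ : ℝ) : Measure (Fin n → ℝ) :=
  Measure.pi (fun _ => gaussianReal θ (Real.toNNReal (σ ^ 2)))

/-- The arithmetic mean of the sample. -/
def sampleMean {n : ℕ} (y : Fin n → ℝ) : ℝ :=
  (∑ i, y i) / (n : ℝ)

/-- The sample standard deviation, with divisor `n - 1` inside the root (used for `n ≥ 2`). -/
def sampleSD {n : ℕ} (y : Fin n → ℝ) : ℝ :=
  Real.sqrt ((∑ i, (y i - sampleMean y) ^ 2) / ((n : ℝ) - 1))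

/-- The adaptive LASSO rule with threshold `t ≥ 0`, applied to the number `x`. -/
def threshold (t x : ℝ) : ℝ :=
  if |x| ≤ t then 0 else x - t ^ 2 / x

/-- For `t ≥ 0` the rule is `x (1 - t² / x²)₊`. -/
theorem threshold_eq {t : ℝ} (ht : 0 ≤ t) (x : ℝ) :
    threshold t x = x * max (1 - t ^ 2 / x ^ 2) 0 := by
  unfold threshold
  by_cases hx : x = 0
  · subst hx
    simp
  have hx2 : 0 < x ^ 2 := by positivity
  split_ifs with h
  · have h1 : x ^ 2 ≤ t ^ 2 := by
      rw [← sq_abs x]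
      gcongr
    rw [max_eq_right]
    · simp
    · have := (one_le_div hx2).2 h1
      linarith
  · have h1 : t ^ 2 ≤ x ^ 2 := by
      rw [← sq_abs x]
      have := not_le.1 h
      gcongr
    rw [max_eq_left]
    · field_simp
    · have := (div_le_one hx2).2 h1
      linarith

/-- The feasible adaptive LASSO estimator, which uses the sample standard deviation. -/
def feasible {n : ℕ} (η : ℝ) (y : Fin n → ℝ) : ℝ :=
  threshold (sampleSD y * η) (sampleMean y)

/-- The infeasible adaptive LASSO estimator, which uses the true standard deviation `σ`. -/
def infeasible {n : ℕ} (σ η : ℝ) (y : Fin n → ℝ) : ℝ :=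
  threshold (σ * η) (sampleMean y)

/-- The infimum over `θ ∈ ℝ` of the probability that the random set `I y` contains `θ` when the
sample `y` is i.i.d. `N(θ, σ²)`. -/
def infCoverage (n : ℕ) (σ : ℝ) (I : (Fin n → ℝ) → Set ℝ) : ℝ :=
  ⨅ θ : ℝ, (sampleLaw n θ σ).real {y | θ ∈ I y}

end AdaptiveLasso

end

namespace AdaptiveLasso

/-! Both intervals come from one procedure with threshold `S * t` and half-width `S * b`, where `t =
σ η`, `b = σ a`, and `S` is `sampleSD y / σ` or `1`. Outside an event that is rare uniformly in `θ`,
`|S - 1| ≤ δ`. For `θ ≥ b + ρ` with `ρ = δ (b + t)`, covering `θ` means that the sample mean lies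
between two values of the inverse rule. The inverse is 1-Lipschitz in threshold and argument, so
replacing `S` by `1` moves these end points by at most `ρ`.

The mean has standard deviation `σ / √n` and `a` is unrestricted, so the cost of such a shift is
bounded in two ways (`abs_gaussianReal_real_Iic_sub_le_of_scale`). If `b ≤ 2t`, it is of order `√n δ
η`. If `b > 2t`, the centred end points are at least `b / 2` away from zero, and a centred Gaussian
density is at most `1 / |z|` whatever its variance, so a relative shift of order `δ` costs order
`δ`. It remains to have `δ → 0`, `√n δ η → 0` and `n δ² → ∞` together, which `η → 0` permits.

Small `|θ|` need no computation of their own: up to the same errors, the coverage at `θ` is at least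
that at `max |θ| (b + ρ)`. Hence the infima compare in both directions
(`infCoverage_le_infCoverage_add`). -/

/-! ### The thresholding rule and its inverse -/

/-- For `t > 0`, the inverse of the thresholding rule `threshold t` on `(0, ∞)`. -/
noncomputable def thresholdInv (t y : ℝ) : ℝ :=
  (y + √(y ^ 2 + 4 * t ^ 2)) / 2

theorem thresholdInv_zero {t : ℝ} (ht : 0 ≤ t) : thresholdInv t 0 = t := by
  have h : √((0 : ℝ) ^ 2 + 4 * t ^ 2) = 2 * t := by
    rw [show (0 : ℝ) ^ 2 + 4 * t ^ 2 = (2 * t) ^ 2 by ring]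
    exact Real.sqrt_sq (by linarith)
  rw [thresholdInv, h]
  ring

theorem le_thresholdInv (t y : ℝ) : y ≤ thresholdInv t y := by
  have h : y ≤ √(y ^ 2 + 4 * t ^ 2) :=
    Real.le_sqrt_of_sq_le (by nlinarith [sq_nonneg t])
  unfold thresholdInv
  linarith

theorem abs_sqrt_sq_add_sq_sub_le (a b c d : ℝ) :
    |√(a ^ 2 + b ^ 2) - √(c ^ 2 + d ^ 2)| ≤ |a - c| + |b - d| := by
  have key : ∀ a b c d : ℝ, √(a ^ 2 + b ^ 2) ≤ √(c ^ 2 + d ^ 2) + (|a - c| + |b - d|) := by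
    intro a b c d
    have h0 := Real.sqrt_nonneg (c ^ 2 + d ^ 2)
    have h1 := Real.sq_sqrt (show 0 ≤ c ^ 2 + d ^ 2 by positivity)
    have hc : |c| ≤ √(c ^ 2 + d ^ 2) := Real.abs_le_sqrt (by nlinarith [sq_nonneg d])
    have hd : |d| ≤ √(c ^ 2 + d ^ 2) := Real.abs_le_sqrt (by nlinarith [sq_nonneg c])
    have e1 : c * (a - c) ≤ √(c ^ 2 + d ^ 2) * |a - c| := by
      calc c * (a - c) ≤ |c * (a - c)| := le_abs_self _
        _ = |c| * |a - c| := abs_mul _ _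
        _ ≤ _ := by gcongr
    have e2 : d * (b - d) ≤ √(c ^ 2 + d ^ 2) * |b - d| := by
      calc d * (b - d) ≤ |d * (b - d)| := le_abs_self _
        _ = |d| * |b - d| := abs_mul _ _
        _ ≤ _ := by gcongr
    apply Real.sqrt_le_iff.2
    refine ⟨by positivity, ?_⟩
    nlinarith [sq_abs (a - c), sq_abs (b - d), mul_nonneg (abs_nonneg (a - c)) (abs_nonneg (b - d))]
  rw [abs_le]
  have h1 := key a b c d
  have h2 := key c d a b
  rw [abs_sub_comm c a, abs_sub_comm d b] at h2
  constructor <;> linarith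

/-- The inverse is half of `y` plus half the Euclidean norm of `(y, 2t)`, whence constant 1 in both
variables. -/
theorem abs_thresholdInv_sub_le (t y t' y' : ℝ) :
    |thresholdInv t y - thresholdInv t' y'| ≤ |y - y'| + |t - t'| := by
  have h := abs_sqrt_sq_add_sq_sub_le y (2 * t) y' (2 * t')
  rw [show 2 * t - 2 * t' = 2 * (t - t') by ring, abs_mul, abs_two,
    show (2 * t) ^ 2 = 4 * t ^ 2 by ring, show (2 * t') ^ 2 = 4 * t' ^ 2 by ring] at h
  unfold thresholdInv
  rw [abs_le] at h ⊢
  have h3 := abs_le.1 (le_refl |y - y'|)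
  constructor <;> linarith [h.1, h.2, h3.1, h3.2]

theorem thresholdInv_mono (t : ℝ) : Monotone (thresholdInv t) := by
  intro y y' hy
  have h := abs_sqrt_sq_add_sq_sub_le y (2 * t) y' (2 * t)
  rw [sub_self, abs_zero, add_zero, show (2 * t) ^ 2 = 4 * t ^ 2 by ring,
    abs_of_nonpos (sub_nonpos.2 hy), abs_le] at h
  unfold thresholdInv
  linarith [h.1, h.2]

theorem thresholdInv_sub_le {t y y' : ℝ} (hy : y ≤ y') :
    thresholdInv t y' - thresholdInv t y ≤ y' - y := by
  have h := abs_thresholdInv_sub_le t y' t y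
  rw [sub_self, abs_zero, add_zero, abs_of_nonneg (sub_nonneg.2 hy)] at h
  exact (le_abs_self _).trans h

/-- With `g = thresholdInv t y`, `g` is the nonnegative root of `g² = y g + t²`, that is, `g - t² /
g = y` when `g ≠ 0`. Taking `y > 0` keeps away from the flat zone and from negative `x`, where the
rule is at most 0. -/
theorem lt_threshold_iff {t y x : ℝ} (ht : 0 ≤ t) (hy : 0 < y) :
    y < threshold t x ↔ thresholdInv t y < x := by
  have h0 := Real.sqrt_nonneg (y ^ 2 + 4 * t ^ 2)
  have h1 := Real.sq_sqrt (show 0 ≤ y ^ 2 + 4 * t ^ 2 by positivity)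
  have h2 : t ≤ thresholdInv t y := by
    simpa only [thresholdInv_zero ht] using thresholdInv_mono t hy.le
  have h3 : thresholdInv t y ^ 2 = y * thresholdInv t y + t ^ 2 := by
    unfold thresholdInv
    nlinarith
  have h4 := le_thresholdInv t y
  set g := thresholdInv t y
  unfold threshold
  split_ifs with h
  · rw [abs_le] at h
    constructor <;> intro <;> linarith
  · rcases lt_abs.1 (not_le.1 h) with hx | hx
    · have hx0 : 0 < x := by linarith
      rw [lt_sub_iff_add_lt, ← lt_sub_iff_add_lt', div_lt_iff₀ hx0]
      constructor
      · intro h5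
        by_contra! h6
        nlinarith
      · intro h5
        nlinarith
    · have hx0 : x < 0 := by linarith
      have : x - t ^ 2 / x ≤ 0 := by
        rw [sub_nonpos, le_div_iff_of_neg hx0]
        nlinarith
      constructor <;> intro <;> linarith

theorem threshold_lt_iff {t y x : ℝ} (ht : 0 ≤ t) (hy : 0 < y) :
    threshold t x < y ↔ x < thresholdInv t y := by
  have h0 := Real.sqrt_nonneg (y ^ 2 + 4 * t ^ 2)
  have h1 := Real.sq_sqrt (show 0 ≤ y ^ 2 + 4 * t ^ 2 by positivity)
  -- Strictness matters: `x = t` is sent to `0 < y`, so it must lie below the inverse.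
  have h2 : t < thresholdInv t y := by
    have : 2 * t < √(y ^ 2 + 4 * t ^ 2) := Real.lt_sqrt_of_sq_lt (by nlinarith [sq_pos_of_pos hy])
    unfold thresholdInv
    linarith
  have h3 : thresholdInv t y ^ 2 = y * thresholdInv t y + t ^ 2 := by
    unfold thresholdInv
    nlinarith
  have h4 := le_thresholdInv t y
  set g := thresholdInv t y
  unfold threshold
  split_ifs with h
  · rw [abs_le] at h
    constructor <;> intro <;> linarith
  · rcases lt_abs.1 (not_le.1 h) with hx | hx
    · have hx0 : 0 < x := by linarith
      rw [sub_lt_iff_lt_add, ← sub_lt_iff_lt_add', lt_div_iff₀ hx0]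
      constructor
      · intro h5
        by_contra! h6
        nlinarith
      · intro h5
        nlinarith
    · have hx0 : x < 0 := by linarith
      have : x - t ^ 2 / x ≤ 0 := by
        rw [sub_nonpos, le_div_iff_of_neg hx0]
        nlinarith
      constructor <;> intro <;> linarith

/-- This crude bound replaces inversion at the lower argument `θ - s b`, which need not be positive
for small `θ`. -/
theorem sub_le_threshold {t : ℝ} (ht : 0 ≤ t) (x : ℝ) : x - t ≤ threshold t x := by
  unfold threshold
  split_ifs with h
  · linarith [(abs_le.1 h).2]
  · rcases lt_abs.1 (not_le.1 h) with hx | hx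
    · have : t ^ 2 / x ≤ t := by
        rw [div_le_iff₀ (by linarith)]
        nlinarith
      linarith
    · have : t ^ 2 / x ≤ 0 := div_nonpos_of_nonneg_of_nonpos (sq_nonneg t) (by linarith)
      linarith

theorem threshold_neg (t x : ℝ) : threshold t (-x) = -threshold t x := by
  unfold threshold
  rw [abs_neg, div_neg]
  split_ifs <;> ring

/-! ### Increments of the Gaussian distribution function -/

theorem gaussianPDFReal_le_inv_sqrt {v : ℝ} (hv : 0 < v) (z : ℝ) :
    gaussianPDFReal 0 v.toNNReal z ≤ (√v)⁻¹ := by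
  rw [gaussianPDFReal, Real.coe_toNNReal _ hv.le]
  have h1 : √v ≤ √(2 * Real.pi * v) :=
    Real.sqrt_le_sqrt (by nlinarith [Real.pi_gt_three])
  have h2 : (√(2 * Real.pi * v))⁻¹ ≤ (√v)⁻¹ := inv_anti₀ (Real.sqrt_pos.2 hv) h1
  have h3 : Real.exp (-(z - 0) ^ 2 / (2 * v)) ≤ 1 := by
    rw [Real.exp_le_one_iff]
    exact div_nonpos_of_nonpos_of_nonneg (by nlinarith [sq_nonneg (z - 0)]) (by positivity)
  calc _ ≤ (√v)⁻¹ * 1 := by gcongr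
    _ = _ := mul_one _

/-- Combine `exp u ≥ 1 + u` at `u = z² / (2v)` with a completed square. The bound is free of `v`,
which is what allows arbitrary half-widths. -/
theorem gaussianPDFReal_le_inv_abs {v : ℝ} (hv : 0 < v) {z : ℝ} (hz : z ≠ 0) :
    gaussianPDFReal 0 v.toNNReal z ≤ |z|⁻¹ := by
  rw [gaussianPDFReal, Real.coe_toNNReal _ hv.le]
  have h1 : √v ≤ √(2 * Real.pi * v) :=
    Real.sqrt_le_sqrt (by nlinarith [Real.pi_gt_three])
  have hw : 0 < √v := Real.sqrt_pos.2 hv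
  have hw2 := Real.sq_sqrt hv.le
  have hz' : 0 < |z| := abs_pos.2 hz
  have h2 : 1 + z ^ 2 / (2 * v) ≤ Real.exp (z ^ 2 / (2 * v)) := by
    linarith [Real.add_one_le_exp (z ^ 2 / (2 * v))]
  have h3 : |z| ≤ √v * (1 + z ^ 2 / (2 * v)) := by
    rw [← hw2, ← sq_abs z, Real.sqrt_sq hw.le]
    have : √v * (1 + |z| ^ 2 / (2 * √v ^ 2)) - |z|
        = ((√v - |z|) ^ 2 + √v ^ 2) / (2 * √v) := by
      field_simp
      ring
    have h4 : 0 ≤ ((√v - |z|) ^ 2 + √v ^ 2) / (2 * √v) := by positivity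
    linarith
  rw [sub_zero, neg_div, Real.exp_neg, ← mul_inv]
  apply inv_anti₀ hz'
  calc |z| ≤ √v * (1 + z ^ 2 / (2 * v)) := h3
    _ ≤ _ := by gcongr

theorem gaussianReal_real_Iic_sub_le {v : ℝ} (hv : 0 < v) {x y C : ℝ} (hxy : x ≤ y)
    (hC : ∀ z ∈ Set.Ioc x y, gaussianPDFReal 0 v.toNNReal z ≤ C) :
    (gaussianReal 0 v.toNNReal).real (Set.Iic y) - (gaussianReal 0 v.toNNReal).real (Set.Iic x)
      ≤ C * (y - x) := by
  have hv' : v.toNNReal ≠ 0 := (Real.toNNReal_pos.2 hv).ne'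
  rw [← measureReal_sdiff (Set.Iic_subset_Iic.2 hxy) measurableSet_Iic, Set.Iic_sdiff_Iic,
    measureReal_def, gaussianReal_apply_eq_integral _ hv',
    ENNReal.toReal_ofReal (integral_nonneg fun z => gaussianPDFReal_nonneg _ _ z)]
  have h := norm_setIntegral_le_of_norm_le_const (μ := volume) (s := Set.Ioc x y)
    (f := gaussianPDFReal 0 v.toNNReal) (C := C) (by simp) (fun z hz => by
      rw [Real.norm_eq_abs, abs_of_nonneg (gaussianPDFReal_nonneg _ _ z)]
      exact hC z hz)
  rw [Real.volume_real_Ioc_of_le hxy] at h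
  exact (le_abs_self _).trans h

theorem abs_gaussianReal_real_Iic_sub_le {v : ℝ} (hv : 0 < v) {x y C : ℝ}
    (hC : ∀ z ∈ Set.uIcc x y, gaussianPDFReal 0 v.toNNReal z ≤ C) :
    |(gaussianReal 0 v.toNNReal).real (Set.Iic y) - (gaussianReal 0 v.toNNReal).real (Set.Iic x)|
      ≤ C * |y - x| := by
  rcases le_total x y with h | h
  · rw [abs_of_nonneg (sub_nonneg.2 h), abs_of_nonneg
      (sub_nonneg.2 (measureReal_mono (Set.Iic_subset_Iic.2 h)))]
    refine gaussianReal_real_Iic_sub_le hv h fun z hz => hC z ?_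
    rw [Set.uIcc_of_le h]
    exact Set.Ioc_subset_Icc_self hz
  · rw [abs_sub_comm, abs_sub_comm y x, abs_of_nonneg (sub_nonneg.2 h), abs_of_nonneg
      (sub_nonneg.2 (measureReal_mono (Set.Iic_subset_Iic.2 h)))]
    refine gaussianReal_real_Iic_sub_le hv h fun z hz => hC z ?_
    rw [Set.uIcc_of_ge h]
    exact Set.Ioc_subset_Icc_self hz

theorem abs_gaussianReal_real_Iic_sub_le_div_sqrt {v : ℝ} (hv : 0 < v) (x y : ℝ) :
    |(gaussianReal 0 v.toNNReal).real (Set.Iic y) - (gaussianReal 0 v.toNNReal).real (Set.Iic x)|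
      ≤ |y - x| / √v := by
  rw [div_eq_inv_mul]
  exact abs_gaussianReal_real_Iic_sub_le hv fun z _ => gaussianPDFReal_le_inv_sqrt hv z

theorem abs_gaussianReal_real_Iic_sub_le_div_abs {v : ℝ} (hv : 0 < v) {x y : ℝ} (hx : x ≠ 0)
    (hxy : |y - x| ≤ |x| / 2) :
    |(gaussianReal 0 v.toNNReal).real (Set.Iic y) - (gaussianReal 0 v.toNNReal).real (Set.Iic x)|
      ≤ 2 * |y - x| / |x| := by
  have hx' : 0 < |x| := abs_pos.2 hx
  rw [mul_div_right_comm]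
  refine abs_gaussianReal_real_Iic_sub_le hv fun z hz => ?_
  have h1 : |z - x| ≤ |y - x| := Set.abs_sub_left_of_mem_uIcc hz
  have h2 : |x| / 2 ≤ |z| := by
    have := abs_sub_abs_le_abs_sub x z
    rw [abs_sub_comm] at this
    linarith
  have h3 : 0 < |z| := by linarith
  refine (gaussianPDFReal_le_inv_abs hv (abs_pos.1 h3)).trans ?_
  rw [← inv_div]
  exact inv_anti₀ (by positivity) h2

/-- No order between `l` and `u` is assumed, because shrinking an interval at both ends may reverse
them; the left side is then nonpositive. -/
theorem gaussianReal_real_Iic_sub_le_Ioo {v : ℝ} (hv : 0 < v) (l u : ℝ) :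
    (gaussianReal 0 v.toNNReal).real (Set.Iic u) - (gaussianReal 0 v.toNNReal).real (Set.Iic l)
      ≤ (gaussianReal 0 v.toNNReal).real (Set.Ioo l u) := by
  have : NullSingletonClass (gaussianReal 0 v.toNNReal) :=
    nullSingletonClass_gaussianReal (Real.toNNReal_pos.2 hv).ne'
  have h1 : (gaussianReal 0 v.toNNReal).real (Set.Ioo l u)
      = (gaussianReal 0 v.toNNReal).real (Set.Ioc l u) := measureReal_congr Ioo_ae_eq_Ioc
  rw [h1, sub_le_iff_le_add']
  refine (measureReal_mono ?_).trans (measureReal_union_le _ _)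
  intro z hz
  rcases le_or_gt z l with h | h
  · exact Or.inl h
  · exact Or.inr ⟨h, hz⟩

theorem gaussianReal_real_Icc {v : ℝ} (hv : 0 < v) {l u : ℝ} (h : l ≤ u) :
    (gaussianReal 0 v.toNNReal).real (Set.Icc l u) =
    (gaussianReal 0 v.toNNReal).real (Set.Iic u)
      - (gaussianReal 0 v.toNNReal).real (Set.Iic l) := by
  have : NullSingletonClass (gaussianReal 0 v.toNNReal) :=
    nullSingletonClass_gaussianReal (Real.toNNReal_pos.2 hv).ne'
  have h1 : (gaussianReal 0 v.toNNReal).real (Set.Icc l u)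
      = (gaussianReal 0 v.toNNReal).real (Set.Ioc l u) := measureReal_congr Ioc_ae_eq_Icc.symm
  rw [h1, ← measureReal_sdiff (Set.Iic_subset_Iic.2 h) measurableSet_Iic, Set.Iic_sdiff_Iic]

/-! ### The law of the sample mean -/

instance (n : ℕ) (θ σ : ℝ) : IsProbabilityMeasure (sampleLaw n θ σ) := by
  unfold sampleLaw
  infer_instance

theorem measurable_sampleMean {n : ℕ} : Measurable (sampleMean (n := n)) := by
  unfold sampleMean
  fun_prop

theorem integral_eval_sampleLaw {n : ℕ} (θ σ : ℝ) (i : Fin n) :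
    ∫ y, y i ∂sampleLaw n θ σ = θ := by
  have h := (measurePreserving_eval (fun _ : Fin n => gaussianReal θ (Real.toNNReal (σ ^ 2)))
    i).map_eq
  have h2 := integral_map (μ := sampleLaw n θ σ) (φ := Function.eval i) (f := fun x : ℝ => x)
    (measurable_pi_apply i).aemeasurable aestronglyMeasurable_id
  rw [sampleLaw, h, integral_id_gaussianReal] at h2
  exact h2.symm

theorem memLp_eval_sampleLaw {n : ℕ} (θ σ : ℝ) (i : Fin n) :
    MemLp (fun y => y i) 2 (sampleLaw n θ σ) :=
  (memLp_id_gaussianReal' (μ := θ) (v := Real.toNNReal (σ ^ 2)) 2 (by simp)).comp_measurePreserving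
    (measurePreserving_eval (fun _ : Fin n => gaussianReal θ (Real.toNNReal (σ ^ 2))) i)

theorem variance_sum_sampleLaw (n : ℕ) (θ σ : ℝ) :
    Var[fun y => ∑ i, y i; sampleLaw n θ σ] = n * σ ^ 2 := by
  have h := variance_sum_pi (ι := Fin n) (Ω := fun _ => ℝ) (X := fun _ x => x)
    (μ := fun _ => gaussianReal θ (Real.toNNReal (σ ^ 2)))
    (fun _ => memLp_id_gaussianReal' 2 (by simp))
  simp only [variance_fun_id_gaussianReal, Finset.sum_const, Finset.card_univ, Fintype.card_fin,
    nsmul_eq_mul, Real.coe_toNNReal _ (sq_nonneg σ)] at h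
  rw [← h, sampleLaw]
  congr 1
  ext y
  simp

/-- The centred sample mean has the law `N(0, σ² / n)`. -/
theorem map_sampleMean_sub {n : ℕ} (hn : n ≠ 0) (θ σ : ℝ) :
    (sampleLaw n θ σ).map (fun y => sampleMean y - θ)
      = gaussianReal 0 (σ ^ 2 / n).toNNReal := by
  have hn' : (n : ℝ) ≠ 0 := Nat.cast_ne_zero.2 hn
  have hG : HasGaussianLaw (fun y : Fin n → ℝ => ∑ i, y i) (sampleLaw n θ σ) := by
    refine iIndepFun.hasGaussianLaw_fun_sum (X := fun i (y : Fin n → ℝ) => y i) (fun i => ?_)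
      (iIndepFun_pi (X := fun _ (x : ℝ) => x) fun _ => aemeasurable_id)
    have h := (measurePreserving_eval (fun _ : Fin n => gaussianReal θ (Real.toNNReal (σ ^ 2)))
      i).map_eq
    constructor
    change IsGaussian (Measure.map (Function.eval i)
      (Measure.pi fun _ : Fin n => gaussianReal θ (Real.toNNReal (σ ^ 2))))
    rw [h]
    infer_instance
  have h1 := hG.map_eq_gaussianReal
  rw [variance_sum_sampleLaw, integral_finsetSum _ fun i _ =>
    (memLp_eval_sampleLaw θ σ i).integrable (by norm_num)] at h1
  simp only [integral_eval_sampleLaw, Finset.sum_const, Finset.card_univ, Fintype.card_fin,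
    nsmul_eq_mul] at h1
  have h2 : (fun y : Fin n → ℝ => sampleMean y - θ)
      = (fun x => x - θ) ∘ (fun x => x / (n : ℝ)) ∘ fun y => ∑ i, y i := rfl
  rw [h2, ← Measure.map_map (by fun_prop) (by fun_prop), ← Measure.map_map (by fun_prop)
    (by fun_prop), h1, gaussianReal_map_div_const, gaussianReal_map_sub_const]
  congr 1
  · field_simp
    ring
  · ext
    push_cast
    rw [Real.coe_toNNReal _ (by positivity), Real.coe_toNNReal _ (by positivity)]
    field_simp

theorem sampleLaw_real_sampleMean_sub_mem {n : ℕ} (hn : n ≠ 0) (θ σ : ℝ) {s : Set ℝ}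
    (hs : MeasurableSet s) :
    (sampleLaw n θ σ).real {y | sampleMean y - θ ∈ s}
      = (gaussianReal 0 (σ ^ 2 / n).toNNReal).real s := by
  rw [← map_sampleMean_sub hn θ σ, map_measureReal_apply
    (measurable_sampleMean.sub_const θ) hs]
  rfl

theorem sampleLaw_real_neg_sampleMean_sub_mem {n : ℕ} (hn : n ≠ 0) (θ σ : ℝ) {s : Set ℝ}
    (hs : MeasurableSet s) :
    (sampleLaw n θ σ).real {y | -(sampleMean y - θ) ∈ s}
      = (gaussianReal 0 (σ ^ 2 / n).toNNReal).real s := by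
  have h := gaussianReal_map_neg (μ := 0) (v := (σ ^ 2 / n).toNNReal)
  rw [neg_zero] at h
  conv_rhs => rw [← h, map_measureReal_apply measurable_neg hs]
  exact sampleLaw_real_sampleMean_sub_mem hn θ σ (measurable_neg hs)

/-! ### Moments and concentration of the sample standard deviation -/

theorem integral_sq_gaussianReal_zero {v : ℝ} (hv : 0 ≤ v) :
    ∫ x, x ^ 2 ∂gaussianReal 0 v.toNNReal = v := by
  have h := variance_of_integral_eq_zero (X := fun x => x) (μ := gaussianReal 0 v.toNNReal)
    aemeasurable_id integral_id_gaussianReal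
  rw [variance_fun_id_gaussianReal, Real.coe_toNNReal _ hv] at h
  exact h.symm

theorem integrable_sq_gaussianReal (m : ℝ) (v : NNReal) :
    Integrable (fun x => x ^ 2) (gaussianReal m v) :=
  (memLp_id_gaussianReal' 2 (by simp)).integrable_sq

/-- Finiteness of the fourth moment makes Chebyshev's inequality applicable to the squares. -/
theorem memLp_sq_gaussianReal (m : ℝ) (v : NNReal) :
    MemLp (fun x => x ^ 2) 2 (gaussianReal m v) := by
  have h := (memLp_id_gaussianReal' (μ := m) (v := v) 4 (by simp)).norm_rpow_div 2
  have h2 : (4 : ENNReal) / 2 = 2 := by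
    rw [show (4 : ENNReal) = 2 * 2 by norm_num]
    exact ENNReal.mul_div_cancel_right (by simp) (by simp)
  rw [h2] at h
  refine h.congr_norm (by fun_prop) (ae_of_all _ fun x => ?_)
  simp

theorem memLp_sub_sq_gaussianReal (m : ℝ) (v : NNReal) :
    MemLp (fun x => (x - m) ^ 2) 2 (gaussianReal m v) := by
  have h := memLp_sq_gaussianReal 0 v
  rw [← sub_self m, ← gaussianReal_map_sub_const m] at h
  exact h.comp_of_map (by fun_prop)

theorem variance_sub_sq_gaussianReal (m : ℝ) (v : NNReal) :
    Var[fun x => (x - m) ^ 2; gaussianReal m v] = Var[fun x => x ^ 2; gaussianReal 0 v] := by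
  have h := gaussianReal_map_sub_const (μ := m) (v := v) m
  rw [sub_self] at h
  rw [← h, variance_map (by fun_prop) (by fun_prop)]
  rfl

theorem integral_sub_sq_gaussianReal (m : ℝ) {v : ℝ} (hv : 0 ≤ v) :
    ∫ x, (x - m) ^ 2 ∂gaussianReal m v.toNNReal = v := by
  have h := gaussianReal_map_sub_const (μ := m) (v := v.toNNReal) m
  rw [sub_self] at h
  have h2 := integral_sq_gaussianReal_zero hv
  rwa [← h, integral_map (by fun_prop) (by fun_prop)] at h2

theorem memLp_sub_sq_sampleLaw {n : ℕ} (θ σ : ℝ) (i : Fin n) :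
    MemLp (fun y => (y i - θ) ^ 2) 2 (sampleLaw n θ σ) :=
  (memLp_sub_sq_gaussianReal θ (Real.toNNReal (σ ^ 2))).comp_measurePreserving
    (measurePreserving_eval (fun _ : Fin n => gaussianReal θ (Real.toNNReal (σ ^ 2))) i)

theorem integral_sum_sub_sq_sampleLaw (n : ℕ) (θ σ : ℝ) :
    ∫ y, ∑ i, (y i - θ) ^ 2 ∂sampleLaw n θ σ = n * σ ^ 2 := by
  rw [integral_finsetSum _ fun i _ => (memLp_sub_sq_sampleLaw θ σ i).integrable (by norm_num)]
  have h : ∀ i : Fin n, ∫ y, (y i - θ) ^ 2 ∂sampleLaw n θ σ = σ ^ 2 := by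
    intro i
    have h1 := (measurePreserving_eval (fun _ : Fin n => gaussianReal θ (Real.toNNReal (σ ^ 2)))
      i).map_eq
    have h2 := integral_map (μ := sampleLaw n θ σ) (φ := Function.eval i)
      (f := fun x : ℝ => (x - θ) ^ 2)
      (measurable_pi_apply i).aemeasurable (by fun_prop)
    rw [sampleLaw, h1, integral_sub_sq_gaussianReal θ (sq_nonneg σ)] at h2
    exact h2.symm
  simp [h]

theorem variance_sum_sub_sq_sampleLaw (n : ℕ) (θ σ : ℝ) :
    Var[fun y => ∑ i, (y i - θ) ^ 2; sampleLaw n θ σ]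
      = n * Var[fun x => x ^ 2; gaussianReal 0 (Real.toNNReal (σ ^ 2))] := by
  have h := variance_sum_pi (ι := Fin n) (Ω := fun _ => ℝ) (X := fun _ x => (x - θ) ^ 2)
    (μ := fun _ => gaussianReal θ (Real.toNNReal (σ ^ 2)))
    (fun _ => memLp_sub_sq_gaussianReal θ _)
  simp only [variance_sub_sq_gaussianReal, Finset.sum_const, Finset.card_univ, Fintype.card_fin,
    nsmul_eq_mul] at h
  rw [← h, sampleLaw]
  congr 1
  ext y
  simp

theorem integral_sampleMean_sub_sq {n : ℕ} (hn : n ≠ 0) (θ σ : ℝ) :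
    ∫ y, (sampleMean y - θ) ^ 2 ∂sampleLaw n θ σ = σ ^ 2 / n := by
  rw [← integral_sq_gaussianReal_zero (v := σ ^ 2 / n) (by positivity),
    ← map_sampleMean_sub hn θ σ,
    integral_map (measurable_sampleMean.sub_const θ).aemeasurable (by fun_prop)]

theorem integrable_sampleMean_sub_sq {n : ℕ} (hn : n ≠ 0) (θ σ : ℝ) :
    Integrable (fun y => (sampleMean y - θ) ^ 2) (sampleLaw n θ σ) := by
  have h := integrable_sq_gaussianReal 0 (σ ^ 2 / n).toNNReal
  rw [← map_sampleMean_sub hn θ σ] at h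
  exact h.comp_measurable (measurable_sampleMean.sub_const θ)

theorem sum_sub_sampleMean_sq {n : ℕ} (hn : n ≠ 0) (θ : ℝ) (y : Fin n → ℝ) :
    ∑ i, (y i - sampleMean y) ^ 2 = ∑ i, (y i - θ) ^ 2 - n * (sampleMean y - θ) ^ 2 := by
  have hn' : (n : ℝ) ≠ 0 := Nat.cast_ne_zero.2 hn
  have h : ∑ i, y i = n * sampleMean y := by
    unfold sampleMean
    field_simp
  have h1 : ∀ i, (y i - sampleMean y) ^ 2
      = (y i - θ) ^ 2 - 2 * (sampleMean y - θ) * y i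
        + ((sampleMean y - θ) * (sampleMean y + θ)) := by
    intro i
    ring
  simp_rw [h1]
  rw [Finset.sum_add_distrib, Finset.sum_sub_distrib, ← Finset.mul_sum, h]
  simp only [Finset.sum_const, Finset.card_univ, Fintype.card_fin, nsmul_eq_mul]
  ring

/-- The relative error of the sample standard deviation is of order `n^(-1/2)` in probability,
uniformly in `θ`. -/
theorem sampleLaw_real_sampleSD_le {n : ℕ} (hn : 2 ≤ n) (θ : ℝ) {σ δ : ℝ} (hσ : 0 < σ)
    (hδ : 0 < δ) :
    (sampleLaw n θ σ).real {y | δ < |sampleSD y / σ - 1|}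
      ≤ 16 * (Var[fun x => x ^ 2; gaussianReal 0 (Real.toNNReal (σ ^ 2))] / σ ^ 4) / (n * δ ^ 2)
        + 8 / (n * δ) := by
  have hn0 : n ≠ 0 := by omega
  have hn2 : (2 : ℝ) ≤ n := by exact_mod_cast hn
  have hnp : (0 : ℝ) < n := by linarith
  set V := Var[fun x => x ^ 2; gaussianReal 0 (Real.toNNReal (σ ^ 2))]
  -- Since `n - 1 ≥ n / 2`, a deviation `δ σ² (n - 1)` is at least `2 c`, so one of the two events
  -- below must contribute `c`. Chebyshev bounds the first and Markov the second; the summand `σ ^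
  -- 2` in the second absorbs the gap between `n` and `n - 1`.
  set c := n * δ * σ ^ 2 / 4 with hc
  have hcp : 0 < c := by positivity
  have hsub : {y : Fin n → ℝ | δ < |sampleSD y / σ - 1|} ⊆
      {y | c ≤ |∑ i, (y i - θ) ^ 2 - n * σ ^ 2|}
        ∪ {y | c ≤ n * (sampleMean y - θ) ^ 2 + σ ^ 2} := by
    intro y hy
    by_contra hcon
    simp only [Set.mem_union, Set.mem_ofPred_eq, not_or, not_le] at hcon hy
    obtain ⟨h1, h2⟩ := hcon
    have hs0 : 0 ≤ sampleSD y / σ := div_nonneg (Real.sqrt_nonneg _) hσ.le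
    have hs2 : (sampleSD y / σ) ^ 2 * (σ ^ 2 * (n - 1))
        = ∑ i, (y i - θ) ^ 2 - n * (sampleMean y - θ) ^ 2 := by
      rw [← sum_sub_sampleMean_sq hn0, div_pow, sampleSD, Real.sq_sqrt
        (div_nonneg (Finset.sum_nonneg fun i _ => sq_nonneg _) (by linarith))]
      have : (n : ℝ) - 1 ≠ 0 := by linarith
      field_simp
    set s := sampleSD y / σ
    set A := ∑ i, (y i - θ) ^ 2
    set B := n * (sampleMean y - θ) ^ 2
    have hB : 0 ≤ B := by positivity
    -- As `s ≥ 0`, `|s² - 1| ≥ |s - 1|`, which removes the square root.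
    have h3 : δ < |s ^ 2 - 1| := by
      rw [show s ^ 2 - 1 = (s - 1) * (s + 1) by ring, abs_mul, abs_of_nonneg (by linarith : 0 ≤ s + 1)]
      nlinarith [abs_nonneg (s - 1)]
    have h4 : |s ^ 2 - 1| * (σ ^ 2 * (n - 1)) < 2 * c := by
      rw [← abs_of_nonneg (show 0 ≤ σ ^ 2 * (n - 1 : ℝ) from
        mul_nonneg (sq_nonneg _) (by linarith)), ← abs_mul]
      rw [abs_lt] at h1 ⊢
      constructor <;> nlinarith [h1.1, h1.2, sq_nonneg σ]
    have h5 : δ * (σ ^ 2 * (n - 1)) ≤ |s ^ 2 - 1| * (σ ^ 2 * (n - 1)) :=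
      mul_le_mul_of_nonneg_right h3.le (mul_nonneg (sq_nonneg _) (by linarith))
    have h6 : 0 < δ * σ ^ 2 := by positivity
    nlinarith
  refine (measureReal_mono hsub).trans ((measureReal_union_le _ _).trans (add_le_add ?_ ?_))
  · have hL : MemLp (fun y => ∑ i, (y i - θ) ^ 2) 2 (sampleLaw n θ σ) :=
      memLp_finsetSum _ fun i _ => memLp_sub_sq_sampleLaw θ σ i
    have h := meas_ge_le_variance_div_sq hL hcp
    rw [integral_sum_sub_sq_sampleLaw, variance_sum_sub_sq_sampleLaw] at h
    have h' := ENNReal.toReal_mono ENNReal.ofReal_ne_top h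
    rw [ENNReal.toReal_ofReal (div_nonneg (mul_nonneg hnp.le (variance_nonneg _ _))
      (sq_nonneg c))] at h'
    refine h'.trans_eq ?_
    rw [hc]
    field_simp
    ring
  · have hI : Integrable (fun y => n * (sampleMean y - θ) ^ 2 + σ ^ 2) (sampleLaw n θ σ) :=
      ((integrable_sampleMean_sub_sq hn0 θ σ).const_mul _).add (integrable_const _)
    have h := mul_meas_ge_le_integral_of_nonneg (ae_of_all _ fun y => by positivity) hI c
    rw [integral_add ((integrable_sampleMean_sub_sq hn0 θ σ).const_mul _) (integrable_const _),
      integral_const_mul, integral_sampleMean_sub_sq hn0, integral_const, probReal_univ,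
      one_smul, ← le_div_iff₀' hcp] at h
    refine h.trans_eq ?_
    rw [hc]
    field_simp
    ring

/-! ### Covering events under a perturbed scale -/

/-- The lower bound on `θ` makes `θ - s b` positive, so the rule can be inverted at both ends. -/
theorem mem_Icc_of_abs_threshold_sub_le {s δ t b θ x : ℝ} (hs : |s - 1| ≤ δ) (hδ : 0 < δ)
    (hδ1 : δ < 1) (ht : 0 < t) (hb : 0 ≤ b) (hθ : b + δ * (b + t) ≤ θ)
    (h : θ ∈ Set.Icc (threshold (s * t) x - s * b) (threshold (s * t) x + s * b)) :
    x - θ ∈ Set.Icc (thresholdInv t (θ - b) - θ - δ * (b + t))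
      (thresholdInv t (θ + b) - θ + δ * (b + t)) := by
  have hs' := abs_le.1 hs
  have hs0 : 0 < s := by linarith
  have hst : 0 < s * t := mul_pos hs0 ht
  have hδt : 0 < δ * t := mul_pos hδ ht
  have hsb : s * b ≤ b + δ * b := by nlinarith
  have hy : 0 < θ - s * b := by nlinarith
  have hy' : 0 < θ + s * b := by nlinarith
  have h1 : thresholdInv (s * t) (θ - s * b) ≤ x := by
    by_contra! hc
    have := (threshold_lt_iff hst.le hy).2 hc
    linarith [h.2]
  have h2 : x ≤ thresholdInv (s * t) (θ + s * b) := by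
    by_contra! hc
    have := (lt_threshold_iff hst.le hy').2 hc
    linarith [h.1]
  have e1 : |(s - 1) * b| ≤ δ * b := by
    rw [abs_mul, abs_of_nonneg hb]
    gcongr
  have e2 : |(s - 1) * t| ≤ δ * t := by
    rw [abs_mul, abs_of_pos ht]
    gcongr
  have h3 := abs_thresholdInv_sub_le (s * t) (θ - s * b) t (θ - b)
  have h4 := abs_thresholdInv_sub_le (s * t) (θ + s * b) t (θ + b)
  rw [show θ - s * b - (θ - b) = -((s - 1) * b) by ring, abs_neg,
    show s * t - t = (s - 1) * t by ring] at h3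
  rw [show θ + s * b - (θ + b) = (s - 1) * b by ring,
    show s * t - t = (s - 1) * t by ring] at h4
  constructor
  · linarith [(abs_le.1 h3).1]
  · linarith [(abs_le.1 h4).2]

/-- The margin is twice the perturbation error `ρ = δ (b + t)`: one `ρ` pays for the change of
scale, the other for the excess of `θ'` over `b` when `θ` is small. -/
theorem mem_Ioo_threshold_of_sub_mem {s δ t b θ x : ℝ} (hs : |s - 1| ≤ δ) (hδ : 0 < δ)
    (hδ1 : δ < 1) (ht : 0 < t) (hb : 0 ≤ b) (hθ : 0 ≤ θ) {θ' : ℝ}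
    (hθ' : θ' = max θ (b + δ * (b + t)))
    (h : x - θ ∈ Set.Ioo (thresholdInv t (θ' - b) - θ' + 2 * (δ * (b + t)))
      (thresholdInv t (θ' + b) - θ' - 2 * (δ * (b + t)))) :
    θ ∈ Set.Ioo (threshold (s * t) x - s * b) (threshold (s * t) x + s * b) := by
  have hs' := abs_le.1 hs
  have hs0 : 0 < s := by linarith
  have hst : 0 < s * t := mul_pos hs0 ht
  have hδt : 0 < δ * t := mul_pos hδ ht
  have hδb : 0 ≤ δ * b := mul_nonneg hδ.le hb
  have hsb : s * b ≤ b + δ * b := by nlinarith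
  -- For `b = 0` the interval in `h` is empty. Positivity is needed because `θ` may be 0 and
  -- inversion at `θ + s b` requires a positive argument.
  have hb0 : 0 < b := by
    rcases hb.eq_or_lt with rfl | hb0
    · have := h.1.trans h.2
      simp only [sub_zero, add_zero] at this
      linarith
    · exact hb0
  have hsb0 : 0 < s * b := mul_pos hs0 hb0
  have e1 : |(s - 1) * b| ≤ δ * b := by
    rw [abs_mul, abs_of_nonneg hb]
    gcongr
  have e2 : |(s - 1) * t| ≤ δ * t := by
    rw [abs_mul, abs_of_pos ht]
    gcongr
  have e1' := abs_le.1 e1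
  have e2' := abs_le.1 e2
  constructor
  · have h4 := abs_thresholdInv_sub_le (s * t) (θ + s * b) t (θ + b)
    rw [show θ + s * b - (θ + b) = (s - 1) * b by ring,
      show s * t - t = (s - 1) * t by ring] at h4
    -- The inverse has slope at most 1, so passing from `θ` up to `θ'` can only lower the centred
    -- upper end point.
    have h5 : thresholdInv t (θ' + b) - thresholdInv t (θ + b) ≤ (θ' + b) - (θ + b) :=
      thresholdInv_sub_le (by linarith [le_max_left θ (b + δ * (b + t))])
    have h6 : x < thresholdInv (s * t) (θ + s * b) := by
      linarith [h.2, (abs_le.1 h4).1]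
    linarith [(threshold_lt_iff hst.le (by linarith)).2 h6]
  · rcases le_total (b + δ * (b + t)) θ with hc | hc
    · rw [max_eq_left hc] at hθ'
      subst hθ'
      have h3 := abs_thresholdInv_sub_le (s * t) (θ' - s * b) t (θ' - b)
      rw [show θ' - s * b - (θ' - b) = -((s - 1) * b) by ring, abs_neg,
        show s * t - t = (s - 1) * t by ring] at h3
      have h6 : thresholdInv (s * t) (θ' - s * b) < x := by
        linarith [h.1, (abs_le.1 h3).2]
      linarith [(lt_threshold_iff hst.le (by linarith)).2 h6]
    -- Here `θ' = b + ρ`, so `h` gives `x - θ > t - b + ρ`, and losing `s t` through thresholding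
    -- still leaves more than `-s b`.
    · rw [max_eq_right hc] at hθ'
      have h3 : t ≤ thresholdInv t (θ' - b) := by
        have := thresholdInv_mono t (show 0 ≤ θ' - b by linarith)
        rwa [thresholdInv_zero ht.le] at this
      have h4 := sub_le_threshold hst.le x
      linarith [h.1]

/-! ### Coverage probabilities -/

/-- A family of random intervals with centre `threshold (S t) ȳ` and half-width `S b`, whose
end points may or may not belong to the intervals. -/
def IsThresholdInterval {n : ℕ} (t b : ℝ) (S : (Fin n → ℝ) → ℝ) (I : (Fin n → ℝ) → Set ℝ) :
    Prop :=
  ∀ y, Set.Ioo (threshold (S y * t) (sampleMean y) - S y * b)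
      (threshold (S y * t) (sampleMean y) + S y * b) ⊆ I y ∧
    I y ⊆ Set.Icc (threshold (S y * t) (sampleMean y) - S y * b)
      (threshold (S y * t) (sampleMean y) + S y * b)

section Coverage

variable {n : ℕ} {σ δ t b ε : ℝ} {S : (Fin n → ℝ) → ℝ} {I : (Fin n → ℝ) → Set ℝ}

theorem coverage_le (hn : n ≠ 0) (hσ : 0 < σ) (hδ : 0 < δ)
    (hδ1 : δ < 1) (ht : 0 < t) (hb : 0 ≤ b) (hI : IsThresholdInterval t b S I) {θ : ℝ}
    (hθ : b + δ * (b + t) ≤ θ) (hε : (sampleLaw n θ σ).real {y | δ < |S y - 1|} ≤ ε) :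
    (sampleLaw n θ σ).real {y | θ ∈ I y} ≤
      (gaussianReal 0 (σ ^ 2 / n).toNNReal).real
        (Set.Iic (thresholdInv t (θ + b) - θ + δ * (b + t)))
      - (gaussianReal 0 (σ ^ 2 / n).toNNReal).real
        (Set.Iic (thresholdInv t (θ - b) - θ - δ * (b + t))) + ε := by
  have hnp : (0 : ℝ) < n := Nat.cast_pos.2 (Nat.pos_of_ne_zero hn)
  have hρ : 0 ≤ δ * (b + t) := by positivity
  have hLU : thresholdInv t (θ - b) ≤ thresholdInv t (θ + b) :=
    thresholdInv_mono t (by linarith)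
  rw [← gaussianReal_real_Icc (by positivity) (by linarith),
    ← sampleLaw_real_sampleMean_sub_mem hn θ σ measurableSet_Icc]
  refine (measureReal_mono ?_).trans ((measureReal_union_le _ _).trans (add_le_add le_rfl hε))
  intro y hy
  rcases le_or_gt |S y - 1| δ with h | h
  · exact Or.inl (mem_Icc_of_abs_threshold_sub_le h hδ hδ1 ht hb hθ ((hI y).2 hy))
  · exact Or.inr h

theorem le_coverage (hn : n ≠ 0) (hσ : 0 < σ) (hδ : 0 < δ)
    (hδ1 : δ < 1) (ht : 0 < t) (hb : 0 ≤ b) (hI : IsThresholdInterval t b S I) {θ θ' : ℝ}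
    (hθ' : θ' = max |θ| (b + δ * (b + t)))
    (hε : (sampleLaw n θ σ).real {y | δ < |S y - 1|} ≤ ε) :
    (gaussianReal 0 (σ ^ 2 / n).toNNReal).real
        (Set.Iic (thresholdInv t (θ' + b) - θ' - 2 * (δ * (b + t))))
      - (gaussianReal 0 (σ ^ 2 / n).toNNReal).real
        (Set.Iic (thresholdInv t (θ' - b) - θ' + 2 * (δ * (b + t)))) - ε
      ≤ (sampleLaw n θ σ).real {y | θ ∈ I y} := by
  have hnp : (0 : ℝ) < n := Nat.cast_pos.2 (Nat.pos_of_ne_zero hn)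
  rw [sub_le_iff_le_add]
  refine (gaussianReal_real_Iic_sub_le_Ioo (by positivity) _ _).trans ?_
  rcases le_total 0 θ with hθ | hθ
  · rw [abs_of_nonneg hθ] at hθ'
    rw [← sampleLaw_real_sampleMean_sub_mem hn θ σ measurableSet_Ioo]
    refine (measureReal_mono ?_).trans ((measureReal_union_le _ _).trans (add_le_add le_rfl hε))
    intro y hy
    rcases le_or_gt |S y - 1| δ with h | h
    · exact Or.inl ((hI y).1 (mem_Ioo_threshold_of_sub_mem h hδ hδ1 ht hb hθ hθ' hy))
    · exact Or.inr h
  -- Negative `θ` reduces to `-θ`: the rule is odd and the centred mean is symmetric.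
  · rw [abs_of_nonpos hθ] at hθ'
    rw [← sampleLaw_real_neg_sampleMean_sub_mem hn θ σ measurableSet_Ioo]
    refine (measureReal_mono ?_).trans ((measureReal_union_le _ _).trans (add_le_add le_rfl hε))
    intro y hy
    rcases le_or_gt |S y - 1| δ with h | h
    · left
      apply (hI y).1
      have h1 := mem_Ioo_threshold_of_sub_mem (x := -sampleMean y) h hδ hδ1 ht hb
        (neg_nonneg.2 hθ) hθ' (by
          rw [← neg_sub']
          exact hy)
      rw [threshold_neg] at h1
      constructor <;> linarith [h1.1, h1.2]
    · exact Or.inr h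

end Coverage

/-! ### Comparison of the infima -/

/-- For `b ≤ 2t` the shift is at most `6 δ t`, and the bound on the density by `1 / √v` is enough.
For `b > 2t` it is at most `3 δ b ≤ 6 δ |w|`, and `δ ≤ 1 / 12` keeps it below `|w| / 2`, so the
bound by `1 / |z|` applies. -/
theorem abs_gaussianReal_real_Iic_sub_le_of_scale {v δ t b w w' : ℝ} (hv : 0 < v) (hδ : 0 < δ)
    (hδ1 : δ ≤ 1 / 12) (ht : 0 < t) (hb : 0 ≤ b) (hw : 2 * t < b → b / 2 ≤ |w|)
    (hw' : |w' - w| ≤ 2 * (δ * (b + t))) :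
    |(gaussianReal 0 v.toNNReal).real (Set.Iic w') - (gaussianReal 0 v.toNNReal).real (Set.Iic w)|
      ≤ 6 * (δ * t / √v) + 12 * δ := by
  have hsv : 0 < √v := Real.sqrt_pos.2 hv
  have hpos : 0 ≤ δ * t / √v := by positivity
  rcases le_or_gt b (2 * t) with h | h
  · have h1 : |w' - w| ≤ 6 * (δ * t) := by nlinarith
    calc _ ≤ |w' - w| / √v := abs_gaussianReal_real_Iic_sub_le_div_sqrt hv w w'
      _ ≤ 6 * (δ * t) / √v := by gcongr
      _ = 6 * (δ * t / √v) := by ring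
      _ ≤ _ := by linarith
  · have h1 := hw h
    have h2 : 0 < |w| := by linarith
    have h3 : |w' - w| ≤ 6 * δ * |w| := by nlinarith
    calc _ ≤ 2 * |w' - w| / |w| :=
          abs_gaussianReal_real_Iic_sub_le_div_abs hv (abs_pos.1 h2) (by nlinarith)
      _ ≤ 2 * (6 * δ * |w|) / |w| := by gcongr
      _ = 12 * δ := by
        field_simp
        ring
      _ ≤ _ := by linarith

theorem bddBelow_range_coverage (n : ℕ) (σ : ℝ) (I : (Fin n → ℝ) → Set ℝ) :
    BddBelow (Set.range fun θ : ℝ => (sampleLaw n θ σ).real {y | θ ∈ I y}) :=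
  ⟨0, by
    rintro _ ⟨θ, rfl⟩
    exact measureReal_nonneg⟩

theorem infCoverage_le_infCoverage_add {n : ℕ} {σ δ t b ε ε' : ℝ} {S S' : (Fin n → ℝ) → ℝ}
    {I I' : (Fin n → ℝ) → Set ℝ} (hn : n ≠ 0) (hσ : 0 < σ) (hδ : 0 < δ) (hδ1 : δ ≤ 1 / 12)
    (ht : 0 < t) (hb : 0 ≤ b) (hI : IsThresholdInterval t b S I)
    (hI' : IsThresholdInterval t b S' I')
    (hε : ∀ θ, (sampleLaw n θ σ).real {y | δ < |S y - 1|} ≤ ε)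
    (hε' : ∀ θ, (sampleLaw n θ σ).real {y | δ < |S' y - 1|} ≤ ε') :
    infCoverage n σ I ≤
      infCoverage n σ I' + (4 * (6 * (δ * t / √(σ ^ 2 / n)) + 12 * δ) + ε + ε') := by
  have hnp : (0 : ℝ) < n := Nat.cast_pos.2 (Nat.pos_of_ne_zero hn)
  have hv : 0 < σ ^ 2 / n := by positivity
  have hρ : 0 ≤ δ * (b + t) := by positivity
  rw [← sub_le_iff_le_add]
  refine le_ciInf fun θ => ?_
  obtain ⟨θ', hθ'⟩ : ∃ θ', θ' = max |θ| (b + δ * (b + t)) := ⟨_, rfl⟩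
  have hle : b + δ * (b + t) ≤ θ' := hθ' ▸ le_max_right _ _
  have h1 := (ciInf_le (bddBelow_range_coverage n σ I) θ').trans
    (coverage_le hn hσ hδ (by linarith) ht hb hI hle (hε θ'))
  have h2 := le_coverage hn hσ hδ (by linarith) ht hb hI' hθ' (hε' θ)
  have hU : 2 * t < b → b / 2 ≤ |thresholdInv t (θ' + b) - θ'| := fun _ =>
    le_trans (by linarith [le_thresholdInv t (θ' + b)]) (le_abs_self _)
  -- Slope at most 1 from the value `t` at 0 puts the lower end point at or below `t - b < -b / 2`.
  have hL : 2 * t < b → b / 2 ≤ |thresholdInv t (θ' - b) - θ'| := by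
    intro h
    have h3 := thresholdInv_sub_le (t := t) (show 0 ≤ θ' - b by linarith)
    rw [thresholdInv_zero ht.le] at h3
    exact le_trans (by linarith) (neg_le_abs _)
  have key := fun {w w' : ℝ} => abs_gaussianReal_real_Iic_sub_le_of_scale (w := w) (w' := w')
    hv hδ hδ1 ht hb
  have k1 := abs_le.1 (key (w' := thresholdInv t (θ' + b) - θ' + δ * (b + t)) hU
    (by rw [add_sub_cancel_left, abs_of_nonneg hρ]; linarith))
  have k2 := abs_le.1 (key (w' := thresholdInv t (θ' + b) - θ' - 2 * (δ * (b + t))) hU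
    (by rw [sub_sub_cancel_left, abs_neg, abs_of_nonneg (by linarith)]))
  have k3 := abs_le.1 (key (w' := thresholdInv t (θ' - b) - θ' - δ * (b + t)) hL
    (by rw [sub_sub_cancel_left, abs_neg, abs_of_nonneg hρ]; linarith))
  have k4 := abs_le.1 (key (w' := thresholdInv t (θ' - b) - θ' + 2 * (δ * (b + t))) hL
    (by rw [add_sub_cancel_left, abs_of_nonneg (by linarith)]))
  unfold infCoverage
  linarith [k1.1, k1.2, k2.1, k2.2, k3.1, k3.2, k4.1, k4.2]

/-! ### Choice of the tolerance and passage to the limit -/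

/-- For positive `η n → 0` there is a null sequence `δ n` of larger order than `n^(-1/2)` such
that `√n δ n η n → 0`. -/
theorem exists_tendsto_sqrt_mul_mul {η : ℕ → ℝ} (hη : ∀ n, 2 ≤ n → 0 < η n)
    (hlim : Tendsto η atTop (𝓝 0)) :
    ∃ δ : ℕ → ℝ, (∀ n, 2 ≤ n → 0 < δ n) ∧ Tendsto δ atTop (𝓝 0) ∧
      Tendsto (fun n : ℕ => √n * (δ n * η n)) atTop (𝓝 0) ∧
      Tendsto (fun n : ℕ => 1 / (n * δ n ^ 2)) atTop (𝓝 0) ∧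
      Tendsto (fun n : ℕ => 1 / (n * δ n)) atTop (𝓝 0) := by
  have hinv : Tendsto (fun n : ℕ => (√(n : ℝ))⁻¹) atTop (𝓝 0) :=
    tendsto_inv_atTop_zero.comp (Real.tendsto_sqrt_atTop.comp tendsto_natCast_atTop_atTop)
  set κ : ℕ → ℝ := fun n => η n + (√(n : ℝ))⁻¹ with hκ
  have hκlim : Tendsto κ atTop (𝓝 0) := by simpa using hlim.add hinv
  have hκs : Tendsto (fun n => √(κ n)) atTop (𝓝 0) := by
    simpa using hκlim.sqrt
  have hinvs : Tendsto (fun n : ℕ => √((√(n : ℝ))⁻¹)) atTop (𝓝 0) := by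
    simpa using hinv.sqrt
  have hn0 : ∀ n : ℕ, 2 ≤ n → 0 < √(n : ℝ) := fun n hn =>
    Real.sqrt_pos.2 (Nat.cast_pos.2 (by omega))
  have hn1 : ∀ n : ℕ, 2 ≤ n → 1 ≤ √(n : ℝ) := fun n hn =>
    Real.one_le_sqrt.2 (by exact_mod_cast (by omega : 1 ≤ n))
  have hκ0 : ∀ n, 2 ≤ n → 0 < κ n := fun n hn => add_pos (hη n hn) (inv_pos.2 (hn0 n hn))
  have hsq : ∀ n : ℕ, √(n : ℝ) ^ 2 = n := fun n => Real.sq_sqrt (Nat.cast_nonneg n)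
  have hδ0 : ∀ n : ℕ, 2 ≤ n → 0 < (√(n : ℝ) * √(κ n))⁻¹ := fun n hn =>
    inv_pos.2 (mul_pos (hn0 n hn) (Real.sqrt_pos.2 (hκ0 n hn)))
  -- With this choice `n δ² = 1 / κ`, and `η ≤ κ` gives `√n δ η ≤ √κ`. The summand `n^(-1/2)` in `κ`
  -- forces `δ ≤ n^(-1/4)`, however fast `η` vanishes.
  refine ⟨fun n => (√n * √(κ n))⁻¹, hδ0, ?_, ?_, ?_, ?_⟩
  · refine squeeze_zero' (eventually_atTop.2 ⟨2, fun n hn => (hδ0 n hn).le⟩)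
      (eventually_atTop.2 ⟨2, fun n hn => ?_⟩) hinvs
    have h1 := hn0 n hn
    have h2 : 0 < √(√(n : ℝ)) := Real.sqrt_pos.2 h1
    have h3 : √((√(n : ℝ))⁻¹) ≤ √(κ n) :=
      Real.sqrt_le_sqrt (by rw [hκ]; linarith [hη n hn])
    rw [Real.sqrt_inv] at h3 ⊢
    apply inv_anti₀ h2
    calc √(√(n : ℝ)) = √(√(n : ℝ)) ^ 2 * (√(√(n : ℝ)))⁻¹ := by field_simp
      _ = √(n : ℝ) * (√(√(n : ℝ)))⁻¹ := by rw [Real.sq_sqrt h1.le]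
      _ ≤ _ := by gcongr
  · refine squeeze_zero' (eventually_atTop.2 ⟨2, fun n hn => ?_⟩)
      (eventually_atTop.2 ⟨2, fun n hn => ?_⟩) hκs
    · exact mul_nonneg (Real.sqrt_nonneg _) (mul_nonneg (hδ0 n hn).le (hη n hn).le)
    · have h1 := hn0 n hn
      have h2 := Real.sqrt_pos.2 (hκ0 n hn)
      have h3 := Real.sq_sqrt (hκ0 n hn).le
      have h4 : η n ≤ κ n := by
        rw [hκ]
        linarith [inv_pos.2 h1]
      have h5 : √(n : ℝ) * ((√(n : ℝ) * √(κ n))⁻¹ * η n) = η n / √(κ n) := by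
        field_simp
      rw [h5, div_le_iff₀ h2]
      nlinarith
  · refine hκlim.congr' (eventually_atTop.2 ⟨2, fun n hn => ?_⟩)
    have h1 := hn0 n hn
    have h2 := Real.sqrt_pos.2 (hκ0 n hn)
    have h3 := Real.sq_sqrt (hκ0 n hn).le
    simp only [inv_pow, mul_pow, h3, hsq]
    have : (n : ℝ) ≠ 0 := by rw [← hsq]; positivity
    field_simp
  · refine squeeze_zero' (eventually_atTop.2 ⟨2, fun n hn => ?_⟩)
      (eventually_atTop.2 ⟨2, fun n hn => ?_⟩) hκs
    · exact div_nonneg zero_le_one (mul_nonneg (Nat.cast_nonneg n) (hδ0 n hn).le)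
    · have h1 := hn0 n hn
      have h2 := Real.sqrt_pos.2 (hκ0 n hn)
      have h5 : 1 / ((n : ℝ) * (√(n : ℝ) * √(κ n))⁻¹) = √(κ n) / √(n : ℝ) := by
        nth_rewrite 1 [← hsq n]
        field_simp
      rw [h5]
      exact div_le_self h2.le (hn1 n hn)

theorem tendsto_infCoverage_sub {σ : ℝ} (hσ : 0 < σ) {η a : ℕ → ℝ}
    (hη : ∀ n, 2 ≤ n → 0 < η n) (ha : ∀ n, 2 ≤ n → 0 ≤ a n) (hlim : Tendsto η atTop (𝓝 0))
    (I I' : (n : ℕ) → (Fin n → ℝ) → Set ℝ)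
    (hI : ∀ n, IsThresholdInterval (σ * η n) (σ * a n) (fun y => sampleSD y / σ) (I n))
    (hI' : ∀ n, IsThresholdInterval (σ * η n) (σ * a n) (fun _ => 1) (I' n)) :
    Tendsto (fun n => infCoverage n σ (I n) - infCoverage n σ (I' n)) atTop (𝓝 0) := by
  obtain ⟨δ, hδ0, hδ, h1, h2, h3⟩ := exists_tendsto_sqrt_mul_mul hη hlim
  -- The variance need not be evaluated: only its independence of `n` and `θ` matters.
  set C := 16 * (Var[fun x => x ^ 2; gaussianReal 0 (Real.toNNReal (σ ^ 2))] / σ ^ 4)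
  have hbound : Tendsto (fun n : ℕ => 4 * (6 * (√n * (δ n * η n)) + 12 * δ n)
      + (C * (1 / (n * δ n ^ 2)) + 8 * (1 / (n * δ n)))) atTop (𝓝 0) := by
    simpa using (((h1.const_mul 6).add (hδ.const_mul 12)).const_mul 4).add
      ((h2.const_mul C).add (h3.const_mul 8))
  refine squeeze_zero_norm' ?_ hbound
  filter_upwards [eventually_ge_atTop 2,
    hδ.eventually (ge_mem_nhds (show (0 : ℝ) < 1 / 12 by norm_num))] with n hn hδn
  have hn0 : n ≠ 0 := by omega
  have hnp : (0 : ℝ) < n := Nat.cast_pos.2 (by omega)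
  have ht := mul_pos hσ (hη n hn)
  have hb := mul_nonneg hσ.le (ha n hn)
  have hε : ∀ θ, (sampleLaw n θ σ).real {y | δ n < |sampleSD y / σ - 1|}
      ≤ C * (1 / (n * δ n ^ 2)) + 8 * (1 / (n * δ n)) := fun θ => by
    rw [mul_one_div, mul_one_div]
    exact sampleLaw_real_sampleSD_le hn θ hσ (hδ0 n hn)
  have hε' : ∀ θ, (sampleLaw n θ σ).real {y | δ n < |(1 : ℝ) - 1|} ≤ 0 := fun θ => by
    have : ¬ δ n < 0 := (hδ0 n hn).not_gt
    simp [this]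
  have hs : δ n * (σ * η n) / √(σ ^ 2 / n) = √n * (δ n * η n) := by
    rw [Real.sqrt_div (sq_nonneg σ), Real.sqrt_sq hσ.le]
    have : 0 < √(n : ℝ) := Real.sqrt_pos.2 hnp
    field_simp
  have k1 := infCoverage_le_infCoverage_add hn0 hσ (hδ0 n hn) hδn ht hb (hI n) (hI' n) hε hε'
  have k2 := infCoverage_le_infCoverage_add hn0 hσ (hδ0 n hn) hδn ht hb (hI' n) (hI n) hε' hε
  rw [hs] at k1 k2
  rw [Real.norm_eq_abs, abs_le]
  constructor <;> linarith

theorem isThresholdInterval_feasible {σ : ℝ} (hσ : 0 < σ) {n : ℕ} (η a : ℝ)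
    {I : (Fin n → ℝ) → Set ℝ}
    (h : ∀ y, Set.Ioo (feasible η y - sampleSD y * a) (feasible η y + sampleSD y * a) ⊆ I y ∧
      I y ⊆ Set.Icc (feasible η y - sampleSD y * a) (feasible η y + sampleSD y * a)) :
    IsThresholdInterval (σ * η) (σ * a) (fun y => sampleSD y / σ) I := by
  intro y
  have e : ∀ x, sampleSD y / σ * (σ * x) = sampleSD y * x := fun x => by field_simp
  simp only [e]
  exact h y

theorem isThresholdInterval_infeasible (σ : ℝ) {n : ℕ} (η a : ℝ)
    {I : (Fin n → ℝ) → Set ℝ}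
    (h : ∀ y, Set.Ioo (infeasible σ η y - σ * a) (infeasible σ η y + σ * a) ⊆ I y ∧
      I y ⊆ Set.Icc (infeasible σ η y - σ * a) (infeasible σ η y + σ * a)) :
    IsThresholdInterval (σ * η) (σ * a) (fun _ => 1) I := by
  intro y
  simp only [one_mul]
  exact h y

end AdaptiveLasso

open AdaptiveLasso in
theorem mainTheorem7 (σ : ℝ) (hσ : 0 < σ) (η a : ℕ → ℝ)
    (hη : ∀ n, 2 ≤ n → 0 < η n) (ha : ∀ n, 2 ≤ n → 0 ≤ a n)
    (hlim : Tendsto η atTop (𝓝 0)) :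
    Tendsto (fun n : ℕ =>
        infCoverage n σ (fun y =>
          Set.Icc (feasible (η n) y - sampleSD y * a n) (feasible (η n) y + sampleSD y * a n))
        - infCoverage n σ (fun y =>
          Set.Icc (infeasible σ (η n) y - σ * a n) (infeasible σ (η n) y + σ * a n)))
      atTop (𝓝 0) ∧
    Tendsto (fun n : ℕ =>
        infCoverage n σ (fun y =>
          Set.Ioo (feasible (η n) y - sampleSD y * a n) (feasible (η n) y + sampleSD y * a n))
        - infCoverage n σ (fun y =>
          Set.Ioo (infeasible σ (η n) y - σ * a n) (infeasible σ (η n) y + σ * a n)))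
      atTop (𝓝 0) ∧
    Tendsto (fun n : ℕ =>
        infCoverage n σ (fun y =>
          Set.Ioc (feasible (η n) y - sampleSD y * a n) (feasible (η n) y + sampleSD y * a n))
        - infCoverage n σ (fun y =>
          Set.Ioc (infeasible σ (η n) y - σ * a n) (infeasible σ (η n) y + σ * a n)))
      atTop (𝓝 0) ∧
    Tendsto (fun n : ℕ =>
        infCoverage n σ (fun y =>
          Set.Ico (feasible (η n) y - sampleSD y * a n) (feasible (η n) y + sampleSD y * a n))
        - infCoverage n σ (fun y =>
          Set.Ico (infeasible σ (η n) y - σ * a n) (infeasible σ (η n) y + σ * a n)))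
      atTop (𝓝 0) := by
  refine ⟨?_, ?_, ?_, ?_⟩
  · exact tendsto_infCoverage_sub hσ hη ha hlim _ _
      (fun n => isThresholdInterval_feasible hσ _ _ fun _ => ⟨Set.Ioo_subset_Icc_self, subset_rfl⟩)
      (fun n => isThresholdInterval_infeasible σ _ _ fun _ =>
        ⟨Set.Ioo_subset_Icc_self, subset_rfl⟩)
  · exact tendsto_infCoverage_sub hσ hη ha hlim _ _
      (fun n => isThresholdInterval_feasible hσ _ _ fun _ => ⟨subset_rfl, Set.Ioo_subset_Icc_self⟩)
      (fun n => isThresholdInterval_infeasible σ _ _ fun _ =>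
        ⟨subset_rfl, Set.Ioo_subset_Icc_self⟩)
  · exact tendsto_infCoverage_sub hσ hη ha hlim _ _
      (fun n => isThresholdInterval_feasible hσ _ _ fun _ =>
        ⟨Set.Ioo_subset_Ioc_self, Set.Ioc_subset_Icc_self⟩)
      (fun n => isThresholdInterval_infeasible σ _ _ fun _ =>
        ⟨Set.Ioo_subset_Ioc_self, Set.Ioc_subset_Icc_self⟩)
  · exact tendsto_infCoverage_sub hσ hη ha hlim _ _
      (fun n => isThresholdInterval_feasible hσ _ _ fun _ =>
        ⟨Set.Ioo_subset_Ico_self, Set.Ico_subset_Icc_self⟩)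
      (fun n => isThresholdInterval_infeasible σ _ _ fun _ =>
        ⟨Set.Ioo_subset_Ico_self, Set.Ico_subset_Icc_self⟩)
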